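/- Let $V$ be a finite-dimensional real vector space and let $G$ be a finite subgroup of $\mathrm{GL}(V)$ generated by reflections (elements of order $2$ of $\mathrm{GL}(V)$ fixing pointwise a hyperplane of $V$). An \emph{involution} of $G$ is an element $u\in G$ with $u^2=1$ (so $u=1$ is allowed); its \emph{degree} $\deg(u)$ is the dimension of the $(-1)$-eigenspace of $u$ in $V$. The \emph{reduced rank} $d=\mathrm{rgr}(G)$ is the maximum of the degrees of the involutions of $G$, and an involution is \emph{maximal} if its degree is $d$. For involutions $u,v$ of $G$, say that $v$ is an \emph{adjoint} of $u$ if $u$ and $v$ commute, $\deg(u)+\deg(v)=\deg(uv)$, and $uv$ is a maximal involution. For an integer $n\ge 0$, let $\mathrm{Inv}_n$ be the set of $G$-conjugacy classes of involutions of degree $n$ of $G$, and let $h_G(t)=\sum_{n\ge 0}|\mathrm{Inv}_n|\,t^n$. Then every involution of $G$ has an adjoint, and this adjoint is unique up to conjugacy: if $v$ and $w$ are both adjoints of an involution $u$, then $v$ and $w$ are conjugate in $G$. Consequently, for $0\le n\le d$, the relation ``being adjoint'' defines a bijection from $\mathrm{Inv}_n$ onto $\mathrm{Inv}_{d-n}$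 (the class $c$ corresponds to the class $c'$ if and only if some $u\in c$ and some $v\in c'$ are adjoint), so that $|\mathrm{Inv}_n|=|\mathrm{Inv}_{d-n}|$, while $\mathrm{Inv}_n=\emptyset$ for $n>d$. Hence $h_G$ is a polynomial of degree $d$ and it is reciprocal, that is, $t^d h_G(1/t)=h_G(t)$. -/

import Mathlib

namespace CoxeterPair

variable {V : Type*} [AddCommGroup V] [Module ℝ V]

/-- A reflection of `V`: an element of order `2` of `GL(V)` which fixes every point of some
hyperplane. -/
def IsReflection (s : V ≃ₗ[ℝ] V) : Prop :=
  orderOf s = 2 ∧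
    ∃ H : Submodule ℝ V, Module.finrank ℝ H + 1 = Module.finrank ℝ V ∧ ∀ x ∈ H, s x = x

/-- `(V, G)` is a Coxeter pair: `G` is finite, and generated by the reflections it contains. -/
def IsCoxeterPair (G : Subgroup (V ≃ₗ[ℝ] V)) : Prop :=
  Finite G ∧ Subgroup.closure {s : V ≃ₗ[ℝ] V | s ∈ G ∧ IsReflection s} = G

/-- An involution of `G` is an element with `u ^ 2 = 1`; the identity is allowed. -/
def IsInvolution {G : Subgroup (V ≃ₗ[ℝ] V)} (u : G) : Prop :=
  u ^ 2 = 1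

/-- The dimension of the `(-1)`-eigenspace. An involution is diagonalizable, so for it this is the
multiplicity of the eigenvalue `-1`. -/
noncomputable def degree {G : Subgroup (V ≃ₗ[ℝ] V)} (u : G) : ℕ :=
  Module.finrank ℝ (Module.End.eigenspace ((u : V ≃ₗ[ℝ] V) : V →ₗ[ℝ] V) (-1))

/-- The reduced rank: the maximum of the degrees of the involutions of `G`
(see `isGreatest_reducedRank`). -/
noncomputable def reducedRank (G : Subgroup (V ≃ₗ[ℝ] V)) : ℕ :=
  sSup {n : ℕ | ∃ u : G, IsInvolution u ∧ degree u = n}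

/-- An involution is maximal if its degree is the reduced rank. -/
def IsMaximalInvolution {G : Subgroup (V ≃ₗ[ℝ] V)} (u : G) : Prop :=
  IsInvolution u ∧ degree u = reducedRank G

/-- The involution `v` is adjoint to the involution `u`. -/
structure IsAdjoint {G : Subgroup (V ≃ₗ[ℝ] V)} (u v : G) : Prop where
  left_involution : IsInvolution u
  right_involution : IsInvolution v
  comm : Commute u v
  degree_add : degree u + degree v = degree (u * v)
  maximal : IsMaximalInvolution (u * v)

/-- The set `Inv_n` of conjugacy classes of `G` consisting of involutions of degree `n`. -/
def invClasses (G : Subgroup (V ≃ₗ[ℝ] V)) (n : ℕ) : Set (ConjClasses G) :=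
  {c | ∃ u : G, IsInvolution u ∧ degree u = n ∧ ConjClasses.mk u = c}

/-- The polynomial `h_G(t) = ∑ |Inv_n| t ^ n`; the degrees of involutions are at most `dim V`,
so that all the nonzero terms are there (see `coeff_invPolynomial`). -/
noncomputable def invPolynomial (G : Subgroup (V ≃ₗ[ℝ] V)) : Polynomial ℤ :=
  ∑ n ∈ Finset.range (Module.finrank ℝ V + 1),
    Polynomial.monomial n ((invClasses G n).ncard : ℤ)

section Facts

variable [FiniteDimensional ℝ V] (G : Subgroup (V ≃ₗ[ℝ] V))

theorem degree_le_finrank {G : Subgroup (V ≃ₗ[ℝ] V)} (u : G) :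
    degree u ≤ Module.finrank ℝ V :=
  Submodule.finrank_le _

theorem isGreatest_reducedRank :
    IsGreatest {n : ℕ | ∃ u : G, IsInvolution u ∧ degree u = n} (reducedRank G) := by
  have hb : BddAbove {n : ℕ | ∃ u : G, IsInvolution u ∧ degree u = n} := by
    refine ⟨Module.finrank ℝ V, ?_⟩
    rintro n ⟨u, -, rfl⟩
    exact degree_le_finrank u
  exact ⟨Nat.sSup_mem ⟨degree (1 : G), 1, one_pow 2, rfl⟩ hb, fun n hn => le_csSup hb hn⟩

theorem coeff_invPolynomial (n : ℕ) :
    (invPolynomial G).coeff n = ((invClasses G n).ncard : ℤ) := by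
  simp only [invPolynomial, Polynomial.finsetSum_coeff, Polynomial.coeff_monomial,
    Finset.sum_ite_eq', Finset.mem_range]
  split_ifs with h
  · rfl
  · have : invClasses G n = ∅ := by
      rw [Set.eq_empty_iff_forall_notMem]
      rintro c ⟨u, -, hu, -⟩
      have := degree_le_finrank u
      omega
    simp [this]

end Facts

end CoxeterPair

/-! Fix a `G`-invariant inner product. For an involution `u` with `(-1)`-eigenspace `U`, degrees add
in a product `u * v` of commuting involutions exactly when `v` fixes `U` pointwise. Moreover an
involution has maximal degree exactly when it is full: no reflection of `G` fixes its
`(-1)`-eigenspace pointwise. Combining the two, the adjoints of `u` are the full involutions of the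
pointwise stabilizer of `U` (`isAdjoint_iff`). They exist, since any maximal involution of the
stabilizer is full.

For uniqueness, the stabilizer is itself a reflection group (Steinberg, `isCoxeterPair_fixator`),
and full involutions of a reflection group are conjugate (`IsFullInvolution.exists_conj`): each
sends some chamber to its opposite, and `G` acts simply transitively on chambers. Simple
transitivity (`eq_one_of_same_chamber`, `exists_same_chamber`) is proved from the roots by the
exchange argument.

Adjointness is symmetric and conjugation-invariant, so it pairs the classes of degree `n` with those
of degree `d - n`, which makes the polynomial reciprocal. -/

namespace CoxeterPair

/-! ### Reflections, roots, simple roots and the exchange property -/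

section RootGeometry

variable {V : Type*} [AddCommGroup V] [Module ℝ V]

/-- `B` is an inner product on `V` which is invariant under `G`. -/
structure IsInvariantInner (B : V →ₗ[ℝ] V →ₗ[ℝ] ℝ) (G : Subgroup (V ≃ₗ[ℝ] V)) : Prop where
  symm : ∀ x y, B x y = B y x
  pos : ∀ x, x ≠ 0 → 0 < B x x
  inv : ∀ g ∈ G, ∀ x y, B (g x) (g y) = B x y

/-- `s` is the orthogonal reflection along the unit vector `a`. -/
def IsReflectionAlong (B : V →ₗ[ℝ] V →ₗ[ℝ] ℝ) (s : V ≃ₗ[ℝ] V) (a : V) : Prop :=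
  B a a = 1 ∧ ∀ x, s x = x - (2 * B a x) • a

/-- The unit normals of the reflections in `G`. -/
def roots (B : V →ₗ[ℝ] V →ₗ[ℝ] ℝ) (G : Subgroup (V ≃ₗ[ℝ] V)) : Set V :=
  {a | ∃ s ∈ G, IsReflectionAlong B s a}

/-- A vector is regular if it is on no reflecting hyperplane of `G`. -/
def IsRegular (B : V →ₗ[ℝ] V →ₗ[ℝ] ℝ) (G : Subgroup (V ≃ₗ[ℝ] V)) (p : V) : Prop :=
  ∀ a ∈ roots B G, B a p ≠ 0

/-- The normals of the walls of the chamber of `p`, on the side of `p`. -/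
def simpleRoots (B : V →ₗ[ℝ] V →ₗ[ℝ] ℝ) (G : Subgroup (V ≃ₗ[ℝ] V)) (p : V) : Set V :=
  {c | c ∈ roots B G ∧ 0 < B c p ∧
    ∀ b ∈ roots B G, 0 < B b p → b ≠ c → 0 < B b (p - (2 * B c p) • c)}

/-- The reflections in the walls of the chamber of `p`. -/
def simpleReflections (B : V →ₗ[ℝ] V →ₗ[ℝ] ℝ) (G : Subgroup (V ≃ₗ[ℝ] V)) (p : V) :
    Set (V ≃ₗ[ℝ] V) :=
  {s | s ∈ G ∧ ∃ c ∈ simpleRoots B G p, IsReflectionAlong B s c}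

theorem exists_isInvariantInner [FiniteDimensional ℝ V] (G : Subgroup (V ≃ₗ[ℝ] V)) [Finite G] :
    ∃ B : V →ₗ[ℝ] V →ₗ[ℝ] ℝ, IsInvariantInner B G := by
  classical
  have := Fintype.ofFinite G
  let b := Module.finBasis ℝ V
  let B : V →ₗ[ℝ] V →ₗ[ℝ] ℝ := LinearMap.mk₂ ℝ
    (fun x y => ∑ g : G, ∑ i, b.repr (g.1 x) i * b.repr (g.1 y) i)
    (by intros; simp [add_mul, Finset.sum_add_distrib])
    (by intros; simp [Finset.mul_sum, mul_assoc])
    (by intros; simp [mul_add, Finset.sum_add_distrib])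
    (by intros; simp [Finset.mul_sum, mul_left_comm])
  have hB : ∀ x y, B x y = ∑ g : G, ∑ i, b.repr (g.1 x) i * b.repr (g.1 y) i := fun _ _ => rfl
  refine ⟨B, ?_, ?_, ?_⟩
  · intro x y
    simp only [hB, mul_comm]
  · intro x hx
    rw [hB]
    refine Finset.sum_pos' (fun g _ => Finset.sum_nonneg fun i _ => mul_self_nonneg _)
      ⟨1, Finset.mem_univ _, ?_⟩
    obtain ⟨i, hi⟩ : ∃ i, b.repr x i ≠ 0 := by
      by_contra! h
      exact hx (b.repr.map_eq_zero_iff.1 (Finsupp.ext h))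
    exact Finset.sum_pos' (fun i _ => mul_self_nonneg _)
      ⟨i, Finset.mem_univ _, mul_self_pos.2 (by simpa using hi)⟩
  · intro g hg x y
    rw [hB, hB]
    exact Fintype.sum_equiv (Equiv.mulRight (⟨g, hg⟩ : G)) _ _ fun h => by simp

variable {B : V →ₗ[ℝ] V →ₗ[ℝ] ℝ} {G : Subgroup (V ≃ₗ[ℝ] V)}

namespace IsReflectionAlong

variable {s t : V ≃ₗ[ℝ] V} {a b x : V}

theorem apply_self (h : IsReflectionAlong B s a) : s a = -a := by
  rw [h.2, h.1]; module

theorem apply_apply (h : IsReflectionAlong B s a) (x : V) : s (s x) = x := by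
  rw [h.2 x, map_sub, map_smul, h.apply_self, h.2 x]; module

theorem mul_self (h : IsReflectionAlong B s a) : s * s = 1 :=
  LinearEquiv.ext h.apply_apply

theorem neg (h : IsReflectionAlong B s a) : IsReflectionAlong B s (-a) := by
  refine ⟨by simp [h.1], fun x => ?_⟩
  rw [h.2 x]; simp

theorem unique (h : IsReflectionAlong B s a) (h' : IsReflectionAlong B t a) : s = t :=
  LinearEquiv.ext fun x => by rw [h.2, h'.2]

theorem eq_or_eq_neg (h : IsReflectionAlong B s a) (h' : IsReflectionAlong B s b) :
    b = a ∨ b = -a := by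
  have h1 : b = (B a b) • a := by
    have h2 := h'.apply_self
    rw [h.2] at h2
    have h3 : (2 : ℝ) • b = (2 : ℝ) • ((B a b) • a) := by
      linear_combination (norm := module) h2
    exact smul_right_injective V (two_ne_zero (α := ℝ)) h3
  have h4 : B a b * B a b = 1 := by
    have h5 := h'.1
    rw [h1] at h5
    simpa [h.1] using h5
  rcases mul_self_eq_one_iff.1 h4 with h6 | h6 <;> rw [h6] at h1
  · left; simpa using h1
  · right; simpa using h1

theorem conj (hB : IsInvariantInner B G) {g : V ≃ₗ[ℝ] V} (hg : g ∈ G)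
    (h : IsReflectionAlong B s a) : IsReflectionAlong B (g * s * g⁻¹) (g a) := by
  refine ⟨by rw [hB.inv g hg, h.1], fun x => ?_⟩
  have h1 : B (g a) x = B a (g⁻¹ x) := by
    rw [← hB.inv g hg a]
    congr 1
    exact (g.apply_symm_apply x).symm
  have h2 : g (g⁻¹ x) = x := g.apply_symm_apply x
  simp only [LinearEquiv.mul_apply, h.2, map_sub, map_smul, h1, h2]

theorem apply_eq_self_iff (h : IsReflectionAlong B s a) : s x = x ↔ B a x = 0 := by
  rw [h.2, sub_eq_self, smul_eq_zero]
  constructor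
  · rintro (h1 | rfl)
    · simpa using h1
    · simp
  · intro h1; left; simp [h1]

theorem isReflection [FiniteDimensional ℝ V] (h : IsReflectionAlong B s a) : IsReflection s := by
  have ha : a ≠ 0 := by rintro rfl; simpa using h.1
  refine ⟨orderOf_eq_prime (by rw [sq, h.mul_self]) ?_, LinearMap.ker (B a), ?_,
    fun x hx => h.apply_eq_self_iff.2 hx⟩
  · rintro rfl
    have h1 : a = -a := h.apply_self
    have h2 := congrArg (B a) h1
    rw [map_neg, h.1] at h2
    norm_num at h2
  · have h1 := LinearMap.finrank_range_add_finrank_ker (B a)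
    have h2 : LinearMap.range (B a) = ⊤ := by
      apply LinearMap.range_eq_top.2
      intro r
      exact ⟨r • a, by simp [h.1]⟩
    rw [h2, finrank_top, Module.finrank_self] at h1
    omega

end IsReflectionAlong

/-- A nonzero vector `v - s v` is negated by `s`, hence orthogonal to the fixed hyperplane by
invariance of `B`. By dimension the hyperplane is its whole orthogonal complement, and it remains to
normalize. -/
theorem IsReflection.exists_isReflectionAlong [FiniteDimensional ℝ V] (hB : IsInvariantInner B G)
    {s : V ≃ₗ[ℝ] V} (hs : s ∈ G) (h : IsReflection s) : ∃ a, IsReflectionAlong B s a := by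
  obtain ⟨h2, H, hH, hfix⟩ := h
  have hss : ∀ x, s (s x) = x := fun x => by
    have h3 := pow_orderOf_eq_one s
    rw [h2, sq] at h3
    exact LinearEquiv.congr_fun h3 x
  obtain ⟨v, hv⟩ : ∃ v, s v ≠ v := by
    by_contra! h3
    have : s = 1 := LinearEquiv.ext h3
    simp [this] at h2
  set c := v - s v with hc
  have hc0 : c ≠ 0 := sub_ne_zero.2 hv.symm
  have hsc : s c = -c := by simp [hc, hss]
  have hperp : ∀ y ∈ H, B c y = 0 := fun y hy => by
    have h4 := hB.inv s hs c y
    rw [hsc, hfix y hy] at h4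
    simp at h4
    linarith
  have hcc := hB.pos c hc0
  have hker : H = LinearMap.ker (B c) := by
    apply Submodule.eq_of_le_of_finrank_le hperp
    have h1 := LinearMap.finrank_range_add_finrank_ker (B c)
    have h2 : LinearMap.range (B c) = ⊤ := by
      apply LinearMap.range_eq_top.2
      intro r
      exact ⟨(r / B c c) • c, by simp; field_simp⟩
    rw [h2, finrank_top, Module.finrank_self] at h1
    omega
  have key : ∀ x, s x = x - (2 * (B c x / B c c)) • c := fun x => by
    have h5 : s (x - (B c x / B c c) • c) = x - (B c x / B c c) • c := by
      apply hfix
      rw [hker, LinearMap.mem_ker]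
      simp; field_simp; simp
    rw [map_sub, map_smul, hsc] at h5
    linear_combination (norm := module) h5
  obtain ⟨r, hr0, hr⟩ : ∃ r : ℝ, r ≠ 0 ∧ r * r = B c c :=
    ⟨_, (Real.sqrt_pos.2 hcc).ne', Real.mul_self_sqrt hcc.le⟩
  refine ⟨r⁻¹ • c, ?_, fun x => ?_⟩
  · simp only [map_smul, LinearMap.smul_apply, smul_eq_mul]
    field_simp
    rw [sq, hr]
  · rw [key]
    congr 1
    simp only [map_smul, LinearMap.smul_apply, smul_eq_mul, smul_smul]
    congr 1
    rw [← hr]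
    field_simp

theorem roots_finite [Finite G] : (roots B G).Finite := by
  have h : roots B G ⊆ ⋃ s : G, {a | IsReflectionAlong B s.1 a} := fun a ⟨s, hs, ha⟩ =>
    Set.mem_iUnion.2 ⟨⟨s, hs⟩, ha⟩
  refine (Set.finite_iUnion fun s => ?_).subset h
  rcases Set.eq_empty_or_nonempty {a | IsReflectionAlong B s.1 a} with h1 | ⟨a, ha⟩
  · rw [h1]; exact Set.finite_empty
  · exact (Set.toFinite {a, -a}).subset fun b hb => ha.eq_or_eq_neg hb

theorem neg_mem_roots {a : V} (h : a ∈ roots B G) : -a ∈ roots B G := by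
  obtain ⟨s, hs, ha⟩ := h
  exact ⟨s, hs, ha.neg⟩

theorem map_mem_roots (hB : IsInvariantInner B G) {g : V ≃ₗ[ℝ] V} (hg : g ∈ G) {a : V}
    (h : a ∈ roots B G) : g a ∈ roots B G := by
  obtain ⟨s, hs, ha⟩ := h
  exact ⟨g * s * g⁻¹, G.mul_mem (G.mul_mem hg hs) (G.inv_mem hg), ha.conj hB hg⟩

theorem IsInvariantInner.apply_inv (hB : IsInvariantInner B G) {g : V ≃ₗ[ℝ] V} (hg : g ∈ G)
    (x y : V) : B (g x) y = B x (g⁻¹ y) := by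
  rw [← hB.inv g hg x]
  congr 1
  exact (g.apply_symm_apply y).symm

theorem IsInvariantInner.apply_reflection (hB : IsInvariantInner B G) {s : V ≃ₗ[ℝ] V}
    (hs : s ∈ G) {a : V} (h : IsReflectionAlong B s a) (x y : V) : B (s x) y = B x (s y) := by
  rw [← hB.inv s hs x, h.apply_apply]

theorem IsInvariantInner.apply_lt_one (hB : IsInvariantInner B G) {a b : V} (ha : B a a = 1)
    (hb : B b b = 1) (hab : a ≠ b) : B a b < 1 := by
  have h := hB.pos _ (sub_ne_zero.2 hab)
  simp only [map_sub, LinearMap.sub_apply, ha, hb, hB.symm b a] at h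
  linarith

/-- Among the roots positive on `p`, maximize the ratio `B b y / B b p`, then minimize `B b p` among
the maximizers, to get `c`. If the reflection along `c` made another positive root `b` negative,
then `d = -(s b)` would be positive with `b + d = (2 * B b c) • c`. Both `b` and `d` would then
attain the maximal ratio, so `B b p + B d p ≥ 2 * B c p` by minimality, contradicting `B b c < 1`.
-/
theorem exists_simpleRoot (hB : IsInvariantInner B G) [Finite G] {p y a : V}
    (hp : IsRegular B G p) (ha : a ∈ roots B G) (hap : 0 < B a p) (hay : 0 < B a y) :
    ∃ c ∈ simpleRoots B G p, 0 < B c y := by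
  have hfin : {b | b ∈ roots B G ∧ 0 < B b p}.Finite := roots_finite.subset fun _ h => h.1
  obtain ⟨m, ⟨hm, hmp⟩, hmax⟩ :=
    Set.exists_max_image _ (fun b => B b y / B b p) hfin ⟨a, ha, hap⟩
  set r := B m y / B m p with hr
  have hle : ∀ b ∈ roots B G, 0 < B b p → B b y ≤ r * B b p := fun b hb hbp =>
    (div_le_iff₀ hbp).1 (hmax b ⟨hb, hbp⟩)
  have hr0 : 0 < r := lt_of_lt_of_le (div_pos hay hap) (hmax a ⟨ha, hap⟩)
  obtain ⟨c, ⟨⟨hc, hcp⟩, hcr⟩, hmin⟩ := Set.exists_min_image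
    {b | (b ∈ roots B G ∧ 0 < B b p) ∧ B b y = r * B b p} (fun b => B b p)
    (hfin.subset fun _ h => h.1) ⟨m, ⟨hm, hmp⟩, by rw [hr]; field_simp⟩
  refine ⟨c, ⟨hc, hcp, fun b hb hbp hbc => ?_⟩, by rw [hcr]; positivity⟩
  obtain ⟨s, hs, hsc⟩ := hc
  by_contra! hneg
  have hb1 : B b b = 1 := by obtain ⟨_, _, h⟩ := hb; exact h.1
  have hlt := hB.apply_lt_one hb1 hsc.1 hbc
  set d := -(s b) with hd
  have hdr : d ∈ roots B G := neg_mem_roots (map_mem_roots hB hs hb)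
  have hde : d = (2 * B b c) • c - b := by
    rw [hd, hsc.2, hB.symm c b]; module
  have hdp : 0 < B d p := by
    have h1 : B d p = - B b (p - (2 * B c p) • c) := by
      rw [hd, ← hsc.2, ← hB.apply_reflection hs hsc]; simp
    have h2 := hp d hdr
    rcases lt_trichotomy (B d p) 0 with h | h | h
    · linarith
    · exact absurd h h2
    · exact h
  have e1 : B d p = 2 * B b c * B c p - B b p := by rw [hde]; simp
  have e2 : B d y = 2 * B b c * B c y - B b y := by rw [hde]; simp
  have l1 := hle b hb hbp
  have l2 := hle d hdr hdp
  have q1 : B b y = r * B b p := by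
    apply le_antisymm l1
    rw [e1, e2, hcr] at l2
    linarith
  have q2 : B d y = r * B d p := by rw [e1, e2, q1, hcr]; ring
  have m1 := hmin b ⟨⟨hb, hbp⟩, q1⟩
  have m2 := hmin d ⟨⟨hdr, hdp⟩, q2⟩
  have m3 : 2 * B b c * B c p < 2 * B c p := by nlinarith
  linarith

/-- Descent on the height `B b p` of a positive root: some simple root `c` has `B c b > 0`, and
unless `b = c`, reflecting `b` along `c` gives a positive root of smaller height whose reflection is
a conjugate of the given one. -/
theorem reflection_mem_closure_simpleReflections (hB : IsInvariantInner B G) [Finite G] {p : V}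
    (hp : IsRegular B G p) {s : V ≃ₗ[ℝ] V} (hs : s ∈ G) {a : V} (hsa : IsReflectionAlong B s a) :
    s ∈ Subgroup.closure (simpleReflections B G p) := by
  wlog hap : 0 < B a p generalizing a
  · refine this hsa.neg ?_
    have := hp a ⟨s, hs, hsa⟩
    simp only [map_neg, LinearMap.neg_apply]
    rcases lt_trichotomy (B a p) 0 with h | h | h
    · linarith
    · exact absurd h this
    · exact absurd h hap
  by_contra hbad
  let bad : Set V := {a | 0 < B a p ∧ ∃ s ∈ G, IsReflectionAlong B s a ∧
    s ∉ Subgroup.closure (simpleReflections B G p)}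
  have hfin : bad.Finite := (roots_finite (B := B) (G := G)).subset
    fun a ⟨_, s, hs, h, _⟩ => ⟨s, hs, h⟩
  obtain ⟨b, ⟨hbp, t, ht, htb, htS⟩, hmin⟩ :=
    Set.exists_min_image bad (fun b => B b p) hfin ⟨a, hap, s, hs, hsa, hbad⟩
  obtain ⟨c, hc, hcb⟩ := exists_simpleRoot hB hp ⟨t, ht, htb⟩ hbp
    (by rw [htb.1]; exact one_pos : 0 < B b b)
  obtain ⟨w, hw, hwc⟩ := hc.1
  have hwS : w ∈ Subgroup.closure (simpleReflections B G p) :=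
    Subgroup.subset_closure ⟨hw, c, hc, hwc⟩
  have hbc : b ≠ c := by
    rintro rfl
    exact htS (htb.unique hwc ▸ hwS)
  have hpos : 0 < B (w b) p := by
    rw [hB.apply_reflection hw hwc, hwc.2]
    exact hc.2.2 b ⟨t, ht, htb⟩ hbp hbc
  have hconj := htb.conj hB hw
  have hmem : w * t * w⁻¹ ∈ Subgroup.closure (simpleReflections B G p) := by
    by_contra hn
    have h1 := hmin (w b)
      ⟨hpos, w * t * w⁻¹, G.mul_mem (G.mul_mem hw ht) (G.inv_mem hw), hconj, hn⟩
    have h2 : B (w b) p = B b p - 2 * B c b * B c p := by rw [hwc.2]; simp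
    have h3 := mul_pos hcb hc.2.1
    simp only [h2] at h1
    nlinarith
  apply htS
  have : t = w⁻¹ * (w * t * w⁻¹) * w := by group
  rw [this]
  exact Subgroup.mul_mem _ (Subgroup.mul_mem _ (Subgroup.inv_mem _ hwS) hmem) hwS

/-- If the hyperplane of `t` separates `p` from its image under a word, then `t` times the word is
obtained by deleting one letter: a first letter equal to `t` cancels, and otherwise it is moved past
`t`, leaving a conjugate of `t` to act on the tail. -/
theorem exchange (hB : IsInvariantInner B G) {p : V} (hp : IsRegular B G p) :
    ∀ (l : List (V ≃ₗ[ℝ] V)) (_ : ∀ s ∈ l, s ∈ simpleReflections B G p) (t : V ≃ₗ[ℝ] V) (b : V),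
      t ∈ G → IsReflectionAlong B t b → B b p * B b (l.prod p) < 0 →
      ∃ l' : List (V ≃ₗ[ℝ] V), (∀ s ∈ l', s ∈ simpleReflections B G p) ∧
        l'.length + 1 = l.length ∧ l'.prod = t * l.prod
  | [], _, t, b, _, _, h => by
    simp only [List.prod_nil, LinearEquiv.coe_one, id_eq] at h
    exact absurd h (not_lt.2 (mul_self_nonneg _))
  | s :: l, hl, t, b, ht, htb, h => by
    obtain ⟨hs, c, hc, hsc⟩ := hl s (by simp)
    have hl' : ∀ s ∈ l, s ∈ simpleReflections B G p := fun s h => hl s (by simp [h])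
    by_cases hts : t = s
    · exact ⟨l, hl', by simp, by rw [hts, List.prod_cons, ← mul_assoc, hsc.mul_self, one_mul]⟩
    have hconj := htb.conj hB hs
    -- The hyperplane of `c` is the only one separating `p` from `s p`, and `b` is neither `c` nor
    -- `-c`.
    have hsign : 0 < B b p * B b (s p) := by
      have hb : b ∈ roots B G := ⟨t, ht, htb⟩
      have hbc : b ≠ c := by rintro rfl; exact hts (htb.unique hsc)
      have hbc' : -b ≠ c := by rintro rfl; exact hts (htb.neg.unique hsc)
      rw [hsc.2]
      rcases lt_or_gt_of_ne (hp b hb) with h1 | h1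
      · have := hc.2.2 (-b) (neg_mem_roots hb) (by simpa using h1) hbc'
        simp only [map_neg, LinearMap.neg_apply] at this
        nlinarith
      · exact mul_pos h1 (hc.2.2 b hb h1 hbc)
    obtain ⟨l', h1, h2, h3⟩ := exchange hB hp l hl' (s * t * s⁻¹) (s b)
      (G.mul_mem (G.mul_mem hs ht) (G.inv_mem hs)) hconj (by
        rw [hB.apply_reflection hs hsc, hB.apply_reflection hs hsc]
        rw [List.prod_cons, LinearEquiv.mul_apply] at h
        by_contra! hn
        have h4 := mul_pos hsign (neg_pos.2 h)
        have h5 : 0 ≤ (B b p * B b p) * (B b (s p) * B b (s (l.prod p))) :=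
          mul_nonneg (mul_self_nonneg _) hn
        nlinarith)
    refine ⟨s :: l', by simpa using ⟨hl s (by simp), h1⟩, by simp [h2], ?_⟩
    rw [List.prod_cons, h3, List.prod_cons]
    have hinv : s⁻¹ = s := inv_eq_of_mul_eq_one_left hsc.mul_self
    have := hsc.mul_self
    rw [hinv, mul_assoc s t s, mul_assoc s, ← mul_assoc s s, this, one_mul, mul_assoc]

end RootGeometry

end CoxeterPair

namespace CoxeterPair

/-! ### Simple transitivity on chambers -/

section Chambers

variable {V : Type*} [AddCommGroup V] [Module ℝ V]
variable {B : V →ₗ[ℝ] V →ₗ[ℝ] ℝ} {G : Subgroup (V ≃ₗ[ℝ] V)}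

theorem closure_simpleReflections [FiniteDimensional ℝ V] (hB : IsInvariantInner B G)
    (hG : IsCoxeterPair G) {p : V} (hp : IsRegular B G p) :
    Subgroup.closure (simpleReflections B G p) = G := by
  have := hG.1
  apply le_antisymm
  · exact (Subgroup.closure_le _).2 fun s hs => hs.1
  · conv_lhs => rw [← hG.2]
    refine (Subgroup.closure_le _).2 fun s ⟨hs, hr⟩ => ?_
    obtain ⟨a, ha⟩ := hr.exists_isReflectionAlong hB hs
    exact reflection_mem_closure_simpleReflections hB hp hs ha

/-- An element of a finite reflection group which preserves a chamber is trivial. -/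
theorem eq_one_of_same_chamber [FiniteDimensional ℝ V] (hB : IsInvariantInner B G)
    (hG : IsCoxeterPair G) {p : V} (hp : IsRegular B G p) {g : V ≃ₗ[ℝ] V} (hg : g ∈ G)
    (h : ∀ a ∈ roots B G, 0 < B a p * B a (g p)) : g = 1 := by
  classical
  have hex : ∃ n, ∃ l : List (V ≃ₗ[ℝ] V), (∀ s ∈ l, s ∈ simpleReflections B G p) ∧
      l.length = n ∧ l.prod = g := by
    rw [← closure_simpleReflections hB hG hp] at hg
    rw [← Subgroup.mem_toSubmonoid, Subgroup.closure_toSubmonoid] at hg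
    obtain ⟨l, hl, rfl⟩ := Submonoid.exists_list_of_mem_closure hg
    -- Letters may a priori be inverses of simple reflections, but these are their own inverses.
    refine ⟨_, l, fun s hs => ?_, rfl, rfl⟩
    rcases hl s hs with h1 | ⟨h2, c, hc, h3⟩
    · exact h1
    · rw [← inv_eq_of_mul_eq_one_left h3.mul_self, inv_inv] at h2 h3
      exact ⟨h2, c, hc, h3⟩
  obtain ⟨l, hl, hlen, hprod⟩ := Nat.find_spec hex
  rcases l with _ | ⟨s, l⟩
  · simpa using hprod.symm
  exfalso
  obtain ⟨hs, c, hc, hsc⟩ := hl s (by simp)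
  -- A shortest nonempty word `s :: l` for `g` can be shortened: `c` has the same sign at `p` and at
  -- `g p`, hence opposite signs at `p` and at `l.prod p`, so `exchange` rewrites `s * l.prod` with
  -- fewer letters.
  have hsep : B c p * B c (l.prod p) < 0 := by
    have h1 := h c hc.1
    rw [← hprod, List.prod_cons, LinearEquiv.mul_apply, ← hB.apply_reflection hs hsc,
      hsc.apply_self] at h1
    simp only [map_neg, LinearMap.neg_apply] at h1
    linarith
  obtain ⟨l', h1, h2, h3⟩ := exchange hB hp l (fun t ht => hl t (by simp [ht])) s c hs hsc hsep
  refine Nat.find_min hex (m := l'.length) ?_ ⟨l', h1, rfl, by rw [h3, ← hprod, List.prod_cons]⟩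
  rw [← hlen, List.length_cons]
  omega

/-- A subspace which is contained in no reflecting hyperplane has a regular vector. -/
theorem exists_regular_mem [Finite G] (U : Submodule ℝ V) (S : Set V) (hS : S ⊆ roots B G)
    (hU : ∀ a ∈ S, ∃ x ∈ U, B a x ≠ 0) : ∃ x ∈ U, ∀ a ∈ S, B a x ≠ 0 := by
  have : Finite S := (roots_finite.subset hS).to_subtype
  by_contra! hcov
  -- A real vector space is not a finite union of proper subspaces.
  obtain ⟨a, ha⟩ := Subspace.exists_eq_top_of_iUnion_eq_univ
    (p := fun a : S => (LinearMap.ker (B a.1)).comap U.subtype) (by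
      refine Set.eq_univ_of_forall fun x => ?_
      obtain ⟨a, ha, h⟩ := hcov x.1 x.2
      exact Set.mem_iUnion.2 ⟨⟨a, ha⟩, h⟩)
  obtain ⟨x, hx, hne⟩ := hU a.1 a.2
  have h1 : (⟨x, hx⟩ : U) ∈ (LinearMap.ker (B a.1)).comap U.subtype := by
    rw [ha]; trivial
  exact hne h1

theorem exists_regular [Finite G] : ∃ p, IsRegular B G p := by
  obtain ⟨x, -, hx⟩ := exists_regular_mem (B := B) (G := G) ⊤ (roots B G) subset_rfl
    fun a ⟨_, _, ha⟩ => ⟨a, trivial, by rw [ha.1]; exact one_ne_zero⟩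
  exact ⟨x, hx⟩

/-- Reflecting in a hyperplane which separates `x` from `y` brings `y` closer to `x`. -/
theorem apply_lt_apply_reflection {s : V ≃ₗ[ℝ] V} {a x y : V} (hB : IsInvariantInner B G)
    (h : IsReflectionAlong B s a) (hneg : B a x * B a y < 0) : B x y < B x (s y) := by
  rw [h.2]
  simp only [map_sub, map_smul, smul_eq_mul, hB.symm x a]
  nlinarith

/-- The group acts transitively on the chambers. -/
theorem exists_same_chamber (hB : IsInvariantInner B G) [Finite G] {x y : V}
    (hx : IsRegular B G x) (hy : IsRegular B G y) :
    ∃ g ∈ G, ∀ a ∈ roots B G, 0 < B a x * B a (g y) := by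
  -- Take the point of the orbit of `y` closest to `x`; a separating hyperplane would allow
  -- reflecting it still closer.
  obtain ⟨g, hg⟩ := Finite.exists_max fun g : G => B x (g.1 y)
  refine ⟨g.1, g.2, fun a ha => ?_⟩
  by_contra! hle
  have h1 : B a (g.1 y) ≠ 0 := by
    have h2 := hy _ (map_mem_roots hB (G.inv_mem g.2) ha)
    rwa [hB.apply_inv (G.inv_mem g.2), inv_inv] at h2
  have hlt := lt_of_le_of_ne hle (mul_ne_zero (hx a ha) h1)
  obtain ⟨s, hs, hsa⟩ := ha
  exact absurd (hg ⟨s * g.1, G.mul_mem hs g.2⟩) (not_le.2 (apply_lt_apply_reflection hB hsa hlt))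

/-! ### Pointwise stabilizers and Steinberg's theorem -/

/-- The pointwise stabilizer of a subspace. -/
def fixator (G : Subgroup (V ≃ₗ[ℝ] V)) (U : Submodule ℝ V) : Subgroup (V ≃ₗ[ℝ] V) where
  carrier := {g | g ∈ G ∧ ∀ x ∈ U, g x = x}
  one_mem' := ⟨G.one_mem, fun _ _ => rfl⟩
  mul_mem' := fun {g h} hg hh => ⟨G.mul_mem hg.1 hh.1, fun x hx => by
    rw [LinearEquiv.mul_apply, hh.2 x hx, hg.2 x hx]⟩
  inv_mem' := fun {g} hg => ⟨G.inv_mem hg.1, fun x hx => by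
    conv_lhs => rw [← hg.2 x hx]
    exact g.symm_apply_apply x⟩

theorem fixator_le (U : Submodule ℝ V) : fixator G U ≤ G := fun _ h => h.1

theorem IsInvariantInner.mono (hB : IsInvariantInner B G) {H : Subgroup (V ≃ₗ[ℝ] V)}
    (h : H ≤ G) : IsInvariantInner B H :=
  ⟨hB.symm, hB.pos, fun g hg => hB.inv g (h hg)⟩

/-- A positive multiple of a small vector does not change the signs of finitely many nonzero
reals. -/
theorem exists_pos_forall_mul_add_pos {ι : Type*} [Finite ι] (r t : ι → ℝ) (hr : ∀ i, r i ≠ 0) :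
    ∃ e > 0, ∀ i, 0 < r i * (r i + e * t i) := by
  have h : ∀ i, ∃ e > 0, ∀ e' > 0, e' ≤ e → 0 < r i * (r i + e' * t i) := fun i => by
    have h1 : 0 < r i * r i := mul_self_pos.2 (hr i)
    -- This bound gives `e' * |r i * t i| < r i * r i`; the `+ 1` keeps the denominator positive.
    refine ⟨r i * r i / (|r i * t i| + 1), by positivity, fun e' he' hle => ?_⟩
    rw [le_div_iff₀ (by positivity)] at hle
    have h2 := neg_abs_le (r i * t i)
    nlinarith
  choose e he hpos using h
  rcases isEmpty_or_nonempty ι with _ | _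
  · exact ⟨1, one_pos, fun i => isEmptyElim i⟩
  obtain ⟨i, hi⟩ := Finite.exists_min e
  exact ⟨e i, he i, fun j => hpos j _ (he i) (hi j)⟩

/-- Steinberg's theorem: the pointwise stabilizer of a subspace is generated by reflections. -/
theorem isCoxeterPair_fixator [FiniteDimensional ℝ V] (hB : IsInvariantInner B G)
    (hG : IsCoxeterPair G) (U : Submodule ℝ V) : IsCoxeterPair (fixator G U) := by
  have := hG.1
  have hfin : Finite (fixator G U) := Finite.of_injective _
    (Subgroup.inclusion_injective (fixator_le U))
  refine ⟨hfin, le_antisymm ((Subgroup.closure_le _).2 fun s hs => hs.1) fun g hg => ?_⟩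
  set K := Subgroup.closure {s : V ≃ₗ[ℝ] V | s ∈ fixator G U ∧ IsReflection s} with hK
  have hKle : K ≤ fixator G U := (Subgroup.closure_le _).2 fun s hs => hs.1
  have : Finite K := Finite.of_injective _ (Subgroup.inclusion_injective hKle)
  obtain ⟨x, hxU, hx⟩ := exists_regular_mem (B := B) (G := G) U
    {a | a ∈ roots B G ∧ ∃ x ∈ U, B a x ≠ 0} (fun a h => h.1) fun a h => h.2
  obtain ⟨z, hz⟩ := exists_regular (B := B) (G := G)
  -- By maximality no root orthogonal to `U` separates `z` from `k g z`, since its reflection lies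
  -- in `K`.
  obtain ⟨k, hk⟩ := Finite.exists_max fun k : K => B z (k.1 (g z))
  have hkg : k.1 * g ∈ fixator G U := Subgroup.mul_mem _ (hKle k.2) hg
  let ι := {a // a ∈ roots B G ∧ ∃ x ∈ U, B a x ≠ 0}
  have : Finite ι := (roots_finite.subset fun a (h : a ∈ {a | a ∈ roots B G ∧ _}) => h.1).to_subtype
  -- One `e` must serve both `x + e • z` and its image `x + e • (k * g) z`; the `Bool` selects
  -- between them.
  obtain ⟨e, he, hsign⟩ := exists_pos_forall_mul_add_pos (ι := ι × Bool)
    (fun i => B i.1.1 x) (fun i => B i.1.1 (if i.2 then z else (k.1 * g) z))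
    (fun i => hx _ i.1.2)
  have hfix : (k.1 * g) (x + e • z) = x + e • (k.1 * g) z := by
    rw [map_add, map_smul, hkg.2 x hxU]
  have hperp : ∀ a ∈ roots B G, (¬ ∃ x ∈ U, B a x ≠ 0) → 0 < B a z * B a ((k.1 * g) z) := by
    intro a ha hU
    push Not at hU
    by_contra! hle
    have h1 : B a ((k.1 * g) z) ≠ 0 := by
      have h2 := hz _ (map_mem_roots hB (G.inv_mem hkg.1) ha)
      rwa [hB.apply_inv (G.inv_mem hkg.1), inv_inv] at h2
    have hlt := lt_of_le_of_ne hle (mul_ne_zero (hz a ha) h1)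
    obtain ⟨s, hs, hsa⟩ := ha
    have hsK : s ∈ K := Subgroup.subset_closure
      ⟨⟨hs, fun y hy => hsa.apply_eq_self_iff.2 (hU y hy)⟩, hsa.isReflection⟩
    exact absurd (hk ⟨s * k.1, K.mul_mem hsK k.2⟩)
      (not_le.2 (apply_lt_apply_reflection hB hsa hlt))
  -- At `x + e • z` and at its image, roots not orthogonal to `U` have their sign at `x`, and the
  -- others are controlled by `hperp`; so `k * g` preserves the chamber.
  have hone : k.1 * g = 1 := by
    refine eq_one_of_same_chamber hB hG (p := x + e • z) ?_ hkg.1 ?_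
    · intro a ha
      by_cases hU : ∃ x ∈ U, B a x ≠ 0
      · have h1 := hsign (⟨a, ha, hU⟩, true)
        simp only [if_true] at h1
        simp only [map_add, map_smul, smul_eq_mul]
        exact right_ne_zero_of_mul h1.ne'
      · push Not at hU
        simp only [map_add, map_smul, smul_eq_mul, hU x hxU, zero_add]
        exact mul_ne_zero he.ne' (hz a ha)
    · intro a ha
      rw [hfix]
      by_cases hU : ∃ x ∈ U, B a x ≠ 0
      · have h1 := hsign (⟨a, ha, hU⟩, true)
        have h2 := hsign (⟨a, ha, hU⟩, false)
        simp only [if_true, Bool.false_eq_true, if_false] at h1 h2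
        simp only [map_add, map_smul, smul_eq_mul]
        have h3 : 0 < B a x * B a x := mul_self_pos.2 (hx a ⟨ha, hU⟩)
        have h4 := mul_pos h1 h2
        rw [mul_mul_mul_comm] at h4
        exact (pos_iff_pos_of_mul_pos h4).1 h3
      · have h1 := hperp a ha hU
        push Not at hU
        simp only [map_add, map_smul, smul_eq_mul, hU x hxU, zero_add]
        have := mul_pos (mul_pos he he) h1
        rwa [mul_mul_mul_comm] at this
  have : g = k.1⁻¹ := eq_inv_of_mul_eq_one_right hone
  rw [this]
  exact K.inv_mem k.2

/-! ### Full involutions and their conjugacy -/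

/-- The `(-1)`-eigenspace. -/
def negSpace (u : V ≃ₗ[ℝ] V) : Submodule ℝ V := Module.End.eigenspace (u : V →ₗ[ℝ] V) (-1)

theorem mem_negSpace {u : V ≃ₗ[ℝ] V} {x : V} : x ∈ negSpace u ↔ u x = -x := by
  simp [negSpace]

/-- An involution of `G` is full if no reflection of `G` fixes its `(-1)`-eigenspace pointwise. -/
structure IsFullInvolution (G : Subgroup (V ≃ₗ[ℝ] V)) (u : V ≃ₗ[ℝ] V) : Prop where
  mem : u ∈ G
  mul_self : u * u = 1
  full : ∀ s ∈ G, IsReflection s → ∃ x ∈ negSpace u, s x ≠ x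

/-- Fullness says that no reflecting hyperplane contains the `(-1)`-eigenspace. A regular vector
there lies in a chamber that `u` sends to its opposite. -/
theorem IsFullInvolution.exists_regular [FiniteDimensional ℝ V]
    [Finite G] {u : V ≃ₗ[ℝ] V} (hu : IsFullInvolution G u) :
    ∃ x, IsRegular B G x ∧ u x = -x := by
  obtain ⟨x, hx, h⟩ := exists_regular_mem (B := B) (G := G) (negSpace u) (roots B G) subset_rfl
    fun a ⟨s, hs, ha⟩ => by
      obtain ⟨x, hx, h⟩ := hu.full s hs ha.isReflection
      exact ⟨x, hx, fun h0 => h (ha.apply_eq_self_iff.2 h0)⟩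
  exact ⟨x, h, mem_negSpace.1 hx⟩

/-- The full involutions are conjugate: they are the longest elements of the group. -/
theorem IsFullInvolution.exists_conj [FiniteDimensional ℝ V] (hB : IsInvariantInner B G)
    (hG : IsCoxeterPair G) {v w : V ≃ₗ[ℝ] V} (hv : IsFullInvolution G v)
    (hw : IsFullInvolution G w) : ∃ g ∈ G, g * v * g⁻¹ = w := by
  have := hG.1
  obtain ⟨x, hx, hvx⟩ := hw.exists_regular (B := B)
  obtain ⟨y, hy, hwy⟩ := hv.exists_regular (B := B)
  obtain ⟨g, hg, hsame⟩ := exists_same_chamber hB hx hy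
  refine ⟨g, hg, ?_⟩
  set m := g * v * g⁻¹ with hm
  have hmG : m ∈ G := G.mul_mem (G.mul_mem hg hv.mem) (G.inv_mem hg)
  have hmm : m * m = 1 := by
    have : m * m = g * (v * v) * g⁻¹ := by rw [hm]; group
    rw [this, hv.mul_self]; group
  have hmy : m (g y) = -(g y) := by
    have : g⁻¹ (g y) = y := g.symm_apply_apply y
    simp [hm, LinearEquiv.mul_apply, this, hwy]
  -- `w` negates `x` and `m` negates `g y`, which lies in the same chamber. Both therefore send this
  -- chamber to its opposite, and their product preserves it.
  have h1 : w * m = 1 := by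
    refine eq_one_of_same_chamber hB hG hx (G.mul_mem hw.mem hmG) fun a ha => ?_
    have hiw : w⁻¹ = w := inv_eq_of_mul_eq_one_left hw.mul_self
    have him : m⁻¹ = m := inv_eq_of_mul_eq_one_left hmm
    have e1 : B a ((w * m) x) = B (m (w a)) x := by
      rw [hB.apply_inv hmG, hB.apply_inv hw.mem, hiw, him]; rfl
    have e2 : B (m (w a)) (g y) = - B (w a) (g y) := by
      rw [hB.apply_inv hmG, him, hmy]; simp
    have e3 : B (w a) x = - B a x := by
      rw [hB.apply_inv hw.mem, hiw, hvx]; simp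
    have s1 := hsame _ (map_mem_roots hB hmG (map_mem_roots hB hw.mem ha))
    have s2 := hsame _ (map_mem_roots hB hw.mem ha)
    rw [e2] at s1
    rw [e3] at s2
    rw [e1]
    by_contra! hle
    have h5 := mul_pos s1 s2
    nlinarith [mul_nonneg (neg_nonneg.2 hle) (mul_self_nonneg (B (w a) (g y)))]
  calc m = w * w * m := by rw [hw.mul_self, one_mul]
    _ = w := by rw [mul_assoc, h1, mul_one]

end Chambers

end CoxeterPair

namespace CoxeterPair

/-! ### Degrees of products, maximal involutions and adjoints -/

section Involutions

variable {V : Type*} [AddCommGroup V] [Module ℝ V]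
variable {B : V →ₗ[ℝ] V →ₗ[ℝ] ℝ} {G : Subgroup (V ≃ₗ[ℝ] V)}

/-- Split a vector into its parts negated and fixed by `u`; on the fixed part `v` acts as `u * v`
does. -/
theorem negSpace_mul_le {u v : V ≃ₗ[ℝ] V} (huv : Commute u v) (hu : u * u = 1) :
    negSpace (u * v) ≤ negSpace u ⊔ negSpace v := by
  intro x hx
  have huu : ∀ y, u (u y) = y := fun y => LinearEquiv.congr_fun hu y
  have hc : v (u x) = u (v x) := (LinearEquiv.congr_fun huv x).symm
  have hx1 : u (v x) = -x := mem_negSpace.1 hx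
  have hx2 : v x = -u x := by rw [← huu (v x), hx1, map_neg]
  have e : x = (1 / 2 : ℝ) • (x - u x) + (1 / 2 : ℝ) • (x + u x) := by module
  rw [e]
  refine Submodule.add_mem_sup (Submodule.smul_mem _ _ (mem_negSpace.2 ?_))
    (Submodule.smul_mem _ _ (mem_negSpace.2 ?_))
  · simp [huu]
  · rw [map_add, hc, hx1, hx2]; abel

/-- The image of `1 - u` is negated by `u`, so `v (1 - u) = 1 - u`. Since `u` and `v` are
self-adjoint for `B`, transposing gives `(1 - u) v = 1 - u`, and comparison gives `v u = u v`. -/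
theorem commute_of_fix_negSpace (hB : IsInvariantInner B G) {u v : V ≃ₗ[ℝ] V} (hu : u ∈ G)
    (hv : v ∈ G) (huu : u * u = 1) (hvv : v * v = 1) (h : ∀ x ∈ negSpace u, v x = x) :
    Commute u v := by
  have hu2 : ∀ y, u (u y) = y := fun y => LinearEquiv.congr_fun huu y
  have hiu : u⁻¹ = u := inv_eq_of_mul_eq_one_left huu
  have hiv : v⁻¹ = v := inv_eq_of_mul_eq_one_left hvv
  have h1 : ∀ x, v (x - u x) = x - u x := fun x => h _ (mem_negSpace.2 (by simp [hu2]))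
  have hnondeg : ∀ y, (∀ x, B x y = 0) → y = 0 := fun y hy => by
    by_contra hne
    exact (hB.pos y hne).ne' (hy y)
  have h2 : ∀ y, v y - u (v y) = y - u y := fun y => by
    refine sub_eq_zero.1 (hnondeg _ fun x => ?_)
    have e1 : B (v (x - u x)) y = B (x - u x) y := by rw [h1]
    rw [hB.apply_inv hv, hiv] at e1
    simp only [map_sub, LinearMap.sub_apply, hB.apply_inv hu, hiu] at e1 ⊢
    linarith
  refine LinearEquiv.ext fun y => ?_
  have e1 := h1 y
  rw [map_sub, ← h2 y] at e1
  exact (sub_right_injective e1).symm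

theorem negSpace_mul_eq {u v : V ≃ₗ[ℝ] V} (huv : Commute u v) (huu : u * u = 1)
    (h : ∀ x ∈ negSpace u, v x = x) : negSpace (u * v) = negSpace u ⊔ negSpace v := by
  have hu2 : ∀ y, u (u y) = y := fun y => LinearEquiv.congr_fun huu y
  refine le_antisymm (negSpace_mul_le huv huu) (sup_le ?_ ?_) <;> intro x hx <;>
    refine mem_negSpace.2 ?_ <;> rw [LinearEquiv.mul_apply]
  · rw [h x hx, mem_negSpace.1 hx]
  · have h1 : v (u x) = u (v x) := (LinearEquiv.congr_fun huv x).symm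
    -- `v` fixes `x - u x`, but also negates it since `v` negates `x` and commutes with `u`; hence
    -- `u x = x`.
    have h2 := h (x - u x) (mem_negSpace.2 (by simp [hu2]))
    have h3 := mem_negSpace.1 hx
    rw [map_sub, h1, h3, map_neg] at h2
    rw [h3, map_neg]
    have h4 : (2 : ℝ) • (x - u x) = 0 := by linear_combination (norm := module) -h2
    have h5 : x - u x = 0 := (smul_eq_zero.1 h4).resolve_left two_ne_zero
    rw [← sub_eq_zero.1 h5]

theorem finrank_negSpace_mul [FiniteDimensional ℝ V] {u v : V ≃ₗ[ℝ] V} (huv : Commute u v)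
    (huu : u * u = 1) (h : ∀ x ∈ negSpace u, v x = x) :
    Module.finrank ℝ (negSpace u) + Module.finrank ℝ (negSpace v) =
      Module.finrank ℝ (negSpace (u * v)) := by
  have h1 := Submodule.finrank_sup_add_finrank_inf_eq (negSpace u) (negSpace v)
  have h2 : negSpace u ⊓ negSpace v = ⊥ := by
    rw [eq_bot_iff]
    rintro x ⟨hx, hx'⟩
    have h3 := h x hx
    rw [mem_negSpace.1 hx'] at h3
    have h4 : (2 : ℝ) • x = 0 := by linear_combination (norm := module) -h3
    exact (smul_eq_zero.1 h4).resolve_left two_ne_zero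
  rw [h2, finrank_bot, add_zero] at h1
  rw [negSpace_mul_eq huv huu h, h1]

/-- Converse of `finrank_negSpace_mul`. By `negSpace_mul_le`, additivity forces the two eigenspaces
to meet trivially, and `v x - x` lies in both. -/
theorem fix_negSpace_of_finrank_add [FiniteDimensional ℝ V] {u v : V ≃ₗ[ℝ] V} (huv : Commute u v)
    (huu : u * u = 1) (hvv : v * v = 1)
    (h : Module.finrank ℝ (negSpace u) + Module.finrank ℝ (negSpace v) =
      Module.finrank ℝ (negSpace (u * v))) : ∀ x ∈ negSpace u, v x = x := by
  intro x hx
  have h1 := Submodule.finrank_sup_add_finrank_inf_eq (negSpace u) (negSpace v)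
  have h2 := Submodule.finrank_mono (negSpace_mul_le huv huu)
  have h3 : negSpace u ⊓ negSpace v = ⊥ := Submodule.finrank_eq_zero.1 (by omega)
  have h4 : v x - x ∈ negSpace u ⊓ negSpace v := by
    refine ⟨Submodule.sub_mem _ (mem_negSpace.2 ?_) hx, mem_negSpace.2 ?_⟩
    · have := LinearEquiv.congr_fun huv x
      simp only [LinearEquiv.mul_apply] at this
      rw [this, mem_negSpace.1 hx, map_neg]
    · have : v (v x) = x := LinearEquiv.congr_fun hvv x
      rw [map_sub, this, neg_sub]
  rw [h3] at h4
  exact sub_eq_zero.1 h4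

theorem IsReflection.mul_self {s : V ≃ₗ[ℝ] V} (hs : IsReflection s) : s * s = 1 := by
  rw [← sq, ← hs.1, pow_orderOf_eq_one]

theorem IsReflection.negSpace_ne_bot {s : V ≃ₗ[ℝ] V} (hs : IsReflection s) :
    negSpace s ≠ ⊥ := by
  intro h
  have h1 : s = 1 := LinearEquiv.ext fun x => by
    have h2 : s (s x) = x := LinearEquiv.congr_fun hs.mul_self x
    have h3 : s x - x ∈ negSpace s := mem_negSpace.2 (by rw [map_sub, h2, neg_sub])
    rw [h] at h3
    exact sub_eq_zero.1 h3
  have h2 := hs.1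
  simp [h1] at h2

theorem isInvolution_iff {u : G} : IsInvolution u ↔ u.1 * u.1 = 1 := by
  rw [IsInvolution, sq, Subtype.ext_iff]; rfl

theorem degree_eq_finrank_negSpace (u : G) : degree u = Module.finrank ℝ (negSpace u.1) := rfl

theorem IsInvolution.conj {u : G} (hu : IsInvolution u) (g : G) :
    IsInvolution (g * u * g⁻¹) := by
  unfold IsInvolution at hu ⊢
  rw [conj_pow, hu]; group

theorem IsAdjoint.symm {u v : G} (h : IsAdjoint u v) : IsAdjoint v u :=
  ⟨h.right_involution, h.left_involution, h.comm.symm, by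
    rw [add_comm, h.degree_add, h.comm.eq], h.comm.eq ▸ h.maximal⟩

theorem IsAdjoint.degree_eq {u v : G} (h : IsAdjoint u v) :
    degree v = reducedRank G - degree u := by
  rw [← h.maximal.2, ← h.degree_add]; omega

/-- Two conjugacy classes are adjoint if they have adjoint representatives. -/
def AdjointClasses (c c' : ConjClasses G) : Prop :=
  ∃ u v : G, ConjClasses.mk u = c ∧ ConjClasses.mk v = c' ∧ IsAdjoint u v

theorem AdjointClasses.symm {c c' : ConjClasses G} (h : AdjointClasses c c') :
    AdjointClasses c' c := by
  obtain ⟨u, v, hu, hv, h⟩ := h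
  exact ⟨v, u, hv, hu, h.symm⟩

theorem degree_conj (g u : G) : degree (g * u * g⁻¹) = degree u := by
  have e : negSpace (g * u * g⁻¹).1 = (negSpace u.1).map (g.1 : V →ₗ[ℝ] V) := by
    ext x
    have h : (g * u * g⁻¹).1 x = g.1 (u.1 (g.1.symm x)) := rfl
    rw [Submodule.mem_map_equiv, mem_negSpace, mem_negSpace, h, ← map_neg,
      LinearEquiv.eq_symm_apply]
  rw [degree_eq_finrank_negSpace, e, LinearEquiv.finrank_map_eq]
  rfl

theorem IsAdjoint.conj {u v : G} (h : IsAdjoint u v) (g : G) :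
    IsAdjoint (g * u * g⁻¹) (g * v * g⁻¹) := by
  have e : g * u * g⁻¹ * (g * v * g⁻¹) = g * (u * v) * g⁻¹ := by group
  refine ⟨h.left_involution.conj g, h.right_involution.conj g, ?_, ?_, ?_⟩
  · have e' : g * v * g⁻¹ * (g * u * g⁻¹) = g * (v * u) * g⁻¹ := by group
    rw [Commute, SemiconjBy, e, e', h.comm.eq]
  · rw [e, degree_conj, degree_conj, degree_conj, h.degree_add]
  · rw [e]
    exact ⟨h.maximal.1.conj g, by rw [degree_conj, h.maximal.2]⟩

variable [FiniteDimensional ℝ V]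

theorem IsInvolution.degree_le {u : G} (hu : IsInvolution u) : degree u ≤ reducedRank G :=
  (isGreatest_reducedRank G).2 ⟨u, hu, rfl⟩

theorem exists_isMaximalInvolution (G : Subgroup (V ≃ₗ[ℝ] V)) :
    ∃ u : G, IsMaximalInvolution u := by
  obtain ⟨u, hu, h⟩ := (isGreatest_reducedRank G).1
  exact ⟨u, hu, h⟩

/-- Multiplying `u` by a reflection that fixes its `(-1)`-eigenspace would give an involution of
larger degree. -/
theorem IsMaximalInvolution.isFullInvolution (hB : IsInvariantInner B G) {u : G}
    (hu : IsMaximalInvolution u) : IsFullInvolution G u.1 := by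
  have huu := isInvolution_iff.1 hu.1
  refine ⟨u.2, huu, fun s hs hr => ?_⟩
  by_contra! hfix
  have hc := commute_of_fix_negSpace hB u.2 hs huu hr.mul_self hfix
  have h1 := finrank_negSpace_mul hc huu hfix
  have h2 : IsInvolution (u * ⟨s, hs⟩ : G) := isInvolution_iff.2 (by
    change (u.1 * s) * (u.1 * s) = 1
    rw [hc.symm.mul_mul_mul_comm, huu, hr.mul_self, one_mul])
  have h3 := h2.degree_le
  rw [← hu.2, degree_eq_finrank_negSpace, degree_eq_finrank_negSpace] at h3
  have h4 : Module.finrank ℝ (negSpace s) ≠ 0 := fun h =>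
    hr.negSpace_ne_bot (Submodule.finrank_eq_zero.1 h)
  change Module.finrank ℝ (negSpace (u.1 * s)) ≤ _ at h3
  omega

/-- A maximal involution exists and is full, so it is conjugate to `u` and has the same degree. -/
theorem IsFullInvolution.isMaximalInvolution (hB : IsInvariantInner B G) (hG : IsCoxeterPair G)
    {u : G} (hu : IsFullInvolution G u.1) : IsMaximalInvolution u := by
  obtain ⟨w, hw⟩ := exists_isMaximalInvolution G
  obtain ⟨g, hg, h⟩ := (hw.isFullInvolution hB).exists_conj hB hG hu
  have h1 : (⟨g, hg⟩ : G) * w * (⟨g, hg⟩ : G)⁻¹ = u := Subtype.ext h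
  rw [← h1]
  exact ⟨hw.1.conj _, by rw [degree_conj, hw.2]⟩

/-- The adjoints of an involution are the full involutions of the pointwise stabilizer of its
`(-1)`-eigenspace. -/
theorem isAdjoint_iff (hB : IsInvariantInner B G) (hG : IsCoxeterPair G) {u v : G}
    (hu : IsInvolution u) :
    IsAdjoint u v ↔ IsFullInvolution (fixator G (negSpace u.1)) v.1 := by
  have huu := isInvolution_iff.1 hu
  constructor
  · intro h
    have hvv := isInvolution_iff.1 h.right_involution
    have hc : Commute u.1 v.1 := congrArg Subtype.val h.comm
    have hfix := fix_negSpace_of_finrank_add hc huu hvv h.degree_add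
    refine ⟨⟨v.2, hfix⟩, hvv, fun s hs hr => ?_⟩
    -- `s` moves some vector negated by `u * v`; as it fixes the component negated by `u`, it moves
    -- the one negated by `v`.
    obtain ⟨x, hx, hne⟩ := (h.maximal.isFullInvolution hB).full s hs.1 hr
    obtain ⟨y, hy, z, hz, rfl⟩ := Submodule.mem_sup.1 (negSpace_mul_le hc huu hx)
    refine ⟨z, hz, fun h0 => hne ?_⟩
    rw [map_add, hs.2 y hy, h0]
  · intro h
    have hfix := h.mem.2
    have hc := commute_of_fix_negSpace hB u.2 v.2 huu h.mul_self hfix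
    refine ⟨hu, isInvolution_iff.2 h.mul_self, Subtype.ext hc,
      finrank_negSpace_mul hc huu hfix, IsFullInvolution.isMaximalInvolution hB hG
        ⟨(u * v).2, ?_, fun s hs hr => ?_⟩⟩
    · change (u.1 * v.1) * (u.1 * v.1) = 1
      rw [hc.symm.mul_mul_mul_comm, huu, h.mul_self, one_mul]
    · have he : negSpace (u * v : G).1 = negSpace u.1 ⊔ negSpace v.1 :=
        negSpace_mul_eq hc huu hfix
      rw [he]
      by_contra! hn
      obtain ⟨x, hx, hne⟩ :=
        h.full s ⟨hs, fun x hx => hn x (Submodule.mem_sup_left hx)⟩ hr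
      exact hne (hn x (Submodule.mem_sup_right hx))

/-! ### Existence and uniqueness of adjoints, bijections of classes, reciprocity -/

theorem exists_isAdjoint (hG : IsCoxeterPair G) {u : G} (hu : IsInvolution u) :
    ∃ v : G, IsAdjoint u v := by
  have := hG.1
  obtain ⟨B, hB⟩ := exists_isInvariantInner G
  obtain ⟨v, hv⟩ := exists_isMaximalInvolution (fixator G (negSpace u.1))
  exact ⟨⟨v.1, v.2.1⟩, (isAdjoint_iff hB hG hu).2
    (hv.isFullInvolution (hB.mono (fixator_le _)))⟩

/-- Steinberg's theorem enters here: conjugacy of full involutions is applied inside the pointwise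
stabilizer, so the conjugating element even fixes the `(-1)`-eigenspace of `u` pointwise. -/
theorem IsAdjoint.isConj (hG : IsCoxeterPair G) {u v w : G} (hv : IsAdjoint u v)
    (hw : IsAdjoint u w) : IsConj v w := by
  have := hG.1
  obtain ⟨B, hB⟩ := exists_isInvariantInner G
  obtain ⟨g, hg, h⟩ := ((isAdjoint_iff hB hG hv.left_involution).1 hv).exists_conj
    (hB.mono (fixator_le _)) (isCoxeterPair_fixator hB hG _)
    ((isAdjoint_iff hB hG hv.left_involution).1 hw)
  exact isConj_iff.2 ⟨⟨g, hg.1⟩, Subtype.ext h⟩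

theorem AdjointClasses.unique (hG : IsCoxeterPair G) {c c' c'' : ConjClasses G}
    (h : AdjointClasses c c') (h' : AdjointClasses c c'') : c' = c'' := by
  obtain ⟨u, v, rfl, rfl, h⟩ := h
  obtain ⟨u', v', hu, rfl, h'⟩ := h'
  obtain ⟨g, rfl⟩ := isConj_iff.1 (ConjClasses.mk_eq_mk_iff_isConj.1 hu)
  exact ConjClasses.mk_eq_mk_iff_isConj.2
    ((h.isConj hG (h'.conj g)).trans (isConj_iff.2 ⟨g, rfl⟩).symm)

/-- The free index `m` lets the lemma also be applied from degree `d - n` back to `n`, with no cast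
along `d - (d - n) = n`. -/
theorem exists_adjointClasses (hG : IsCoxeterPair G) {n m : ℕ} (hm : reducedRank G - n = m)
    (c : invClasses G n) : ∃ c' : invClasses G m, AdjointClasses c.1 c'.1 := by
  obtain ⟨_, u, hu, rfl, rfl⟩ := c
  obtain ⟨v, hv⟩ := exists_isAdjoint hG hu
  exact ⟨⟨_, v, hv.right_involution, by rw [hv.degree_eq, hm], rfl⟩, u, v, rfl, rfl, hv⟩

theorem exists_equiv_invClasses (hG : IsCoxeterPair G) {n : ℕ} (hn : n ≤ reducedRank G) :
    ∃ f : invClasses G n ≃ invClasses G (reducedRank G - n),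
      ∀ c c', f c = c' ↔ AdjointClasses c.1 c'.1 := by
  choose f hf using exists_adjointClasses hG (n := n) rfl
  have hbij : Function.Bijective f := by
    refine ⟨fun c c' h => Subtype.ext ?_, fun c' => ?_⟩
    · exact (hf c).symm.unique hG (h ▸ (hf c').symm)
    · obtain ⟨c, hc⟩ := exists_adjointClasses hG (m := n) (by omega) c'
      exact ⟨c, Subtype.ext ((hf c).unique hG hc.symm)⟩
  refine ⟨Equiv.ofBijective f hbij, fun c c' => ⟨?_, fun h => Subtype.ext ((hf c).unique hG h)⟩⟩
  rintro rfl
  exact hf c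

theorem ncard_invClasses_sub (hG : IsCoxeterPair G) {n : ℕ} (hn : n ≤ reducedRank G) :
    (invClasses G n).ncard = (invClasses G (reducedRank G - n)).ncard := by
  obtain ⟨f, -⟩ := exists_equiv_invClasses hG hn
  exact Nat.card_congr f

theorem invClasses_eq_empty {n : ℕ} (hn : reducedRank G < n) : invClasses G n = ∅ := by
  rw [Set.eq_empty_iff_forall_notMem]
  rintro c ⟨u, hu, rfl, -⟩
  exact absurd hu.degree_le (not_le.2 hn)

theorem ncard_invClasses_reducedRank_ne_zero (hG : IsCoxeterPair G) :
    (invClasses G (reducedRank G)).ncard ≠ 0 := by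
  have := hG.1
  obtain ⟨u, hu, h⟩ := exists_isMaximalInvolution G
  -- `Set.ncard` is `0` on infinite sets, so finiteness of `G` matters.
  exact Set.ncard_ne_zero_of_mem (a := ConjClasses.mk u) ⟨u, hu, h, rfl⟩ (Set.toFinite _)

theorem natDegree_invPolynomial (hG : IsCoxeterPair G) :
    (invPolynomial G).natDegree = reducedRank G := by
  refine Polynomial.natDegree_eq_of_le_of_coeff_ne_zero
    (Polynomial.natDegree_le_iff_coeff_eq_zero.2 fun n hn => ?_) ?_
  · rw [coeff_invPolynomial, invClasses_eq_empty hn, Set.ncard_empty, Nat.cast_zero]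
  · rw [coeff_invPolynomial]
    exact_mod_cast ncard_invClasses_reducedRank_ne_zero hG

/-- `Polynomial.reverse` reflects exponents at `natDegree`, so it is `t ^ d * h(1 / t)` once the
degree is known to be `d`. -/
theorem reverse_invPolynomial (hG : IsCoxeterPair G) :
    (invPolynomial G).reverse = invPolynomial G := by
  ext n
  rw [Polynomial.coeff_reverse, natDegree_invPolynomial hG]
  rcases le_or_gt n (reducedRank G) with h | h
  · rw [Polynomial.revAt_le h, coeff_invPolynomial, coeff_invPolynomial,
      ← ncard_invClasses_sub hG h]
  · rw [Polynomial.revAt_eq_self_of_lt h]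

end Involutions

end CoxeterPair

theorem mainTheorem3 {V : Type*} [AddCommGroup V] [Module ℝ V] [FiniteDimensional ℝ V]
    (G : Subgroup (V ≃ₗ[ℝ] V)) (hG : CoxeterPair.IsCoxeterPair G) :
    -- every involution has an adjoint
    (∀ u : G, CoxeterPair.IsInvolution u → ∃ v : G, CoxeterPair.IsAdjoint u v) ∧
    -- the adjoint is unique up to conjugacy
    (∀ u v w : G, CoxeterPair.IsAdjoint u v → CoxeterPair.IsAdjoint u w → IsConj v w) ∧
    -- adjointness defines a bijection from `Inv_n` to `Inv_{d-n}`, where `d` is the reduced rank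
    (∀ n ≤ CoxeterPair.reducedRank G,
      ∃ f : CoxeterPair.invClasses G n ≃
          CoxeterPair.invClasses G (CoxeterPair.reducedRank G - n),
        ∀ c c', f c = c' ↔ ∃ u v : G, ConjClasses.mk u = (c : ConjClasses G) ∧
          ConjClasses.mk v = (c' : ConjClasses G) ∧ CoxeterPair.IsAdjoint u v) ∧
    -- hence the numbers of classes agree, and `Inv_n` is empty beyond `d`
    (∀ n ≤ CoxeterPair.reducedRank G,
      (CoxeterPair.invClasses G n).ncard =
        (CoxeterPair.invClasses G (CoxeterPair.reducedRank G - n)).ncard) ∧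
    (∀ n, CoxeterPair.reducedRank G < n → CoxeterPair.invClasses G n = ∅) ∧
    -- `h_G` has degree `d` and is a reciprocal polynomial
    (CoxeterPair.invPolynomial G).natDegree = CoxeterPair.reducedRank G ∧
    (CoxeterPair.invPolynomial G).reverse = CoxeterPair.invPolynomial G := by
  exact ⟨fun u hu => CoxeterPair.exists_isAdjoint hG hu, fun u v w hv hw => hv.isConj hG hw,
    fun n hn => CoxeterPair.exists_equiv_invClasses hG hn,
    fun n hn => CoxeterPair.ncard_invClasses_sub hG hn,
    fun n hn => CoxeterPair.invClasses_eq_empty hn,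
    CoxeterPair.natDegree_invPolynomial hG, CoxeterPair.reverse_invPolynomial hG⟩
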